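/- Let $M$ be a smooth manifold of dimension $4$, with induced coordinates $(x,y)$ on $TM$ and $\partial_\mu=\partial/\partial x^\mu$, $\bar\partial_\mu=\partial/\partial y^\mu$. A Finsler spacetime structure on $M$ consists of an open set $\mathcal A\subset TM\setminus 0$ with non-empty fibers over all of $M$, invariant under $(x,y)\mapsto(x,\lambda y)$ for $\lambda>0$, and a smooth function $F:\mathcal A\to\mathbb R$ with $F(x,\lambda y)=\lambda F(x,y)$ for all $\lambda>0$, whose fundamental tensor $g_{\mu\nu}=\bar\partial_\mu\bar\partial_\nu(\tfrac12F^2)$ has Lorentzian signature, $(-,+,+,+)$ or $(+,-,-,-)$, at each point of $\mathcal A$. Its Cartan nonlinear connection is $$N^\rho_\mu=\tfrac14\bar\partial_\mu\Big(g^{\rho\sigma}\big(y^\nu\partial_\nu\bar\partial_\sigma F^2-\partial_\sigma F^2\big)\Big),$$ and with $\delta_\mu=\partial_\mu-N^\rho_\mu\bar\partial_\rho$ one sets $$R^\rho{}_{\mu\nu}=\delta_\mu N^\rho_\nu-\delta_\nu N^\rho_\mu,\qquad \mathrm{Ric}=R^\rho{}_{\rho\mu}y^\mu,\qquad R_{\mu\nu}=\tfrac12\bar\partial_\mu\bar\partial_\nu\mathrm{Ric}.$$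 $F$ is called Berwald if in every chart there are functions $\Gamma^\rho_{\mu\nu}(x)$ with $N^\rho_\mu(x,y)=\Gamma^\rho_{\mu\nu}(x)y^\nu$ on $\mathcal A$. Let $a_{\mu\nu}$ be a smooth pseudo-Riemannian metric on $M$ (of any signature, in particular Lorentzian), let $b_\mu$ be a smooth $1$-form on $M$, and put $A=a_{\mu\nu}y^\mu y^\nu$, $\alpha=\sqrt{|A|}$, $\beta=b_\mu y^\mu$. Let $F$ be an $(\alpha,\beta)$-metric, that is, a Finsler metric that on $\mathcal A$ is a function of $\alpha$ and $\beta$ only, where different functions are allowed for $A>0$, $A=0$ and $A<0$; so $F=\alpha\,\phi(\beta/\alpha)$ wherever $\alpha\neq0$, for a function $\phi$ that may depend on $\mathrm{sgn}(A)$ and of which no regularity is assumed. Theorem. Suppose that $a$ is a vacuum solution of Einstein's equations, i.e. its Ricci tensor vanishes, and that $b$ is covariantly constant with respect to the Levi-Civita connection of $a$, i.e. $\nabla_\mu b_\nu=0$. Then $F$ is a Berwald metric and a vacuum solution of the Pfeifer–Wohlfarth field equation of Finsler gravity, which for Berwald metrics takes the form $$\big(F^2g^{\mu\nu}-3y^\mu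 y^\nu\big)R_{\mu\nu}=0\qquad\text{on }\mathcal A.$$ -/

import Mathlib

open scoped Manifold ContDiff Bundle

noncomputable section

namespace FinslerGravity

/-- The coordinate space of a four-dimensional spacetime. -/
abbrev E4 : Type := EuclideanSpace ℝ (Fin 4)

/-! ## Calculus in induced coordinates `(x, y)`

A function on (an open part of) the tangent bundle is written in induced coordinates as a function
`f : E4 → E4 → ℝ`, `(x, y) ↦ f x y`. -/

/-- The coordinate vector `∂_μ`. -/
def basisVec (μ : Fin 4) : E4 := EuclideanSpace.single μ (1 : ℝ)

/-- The partial derivative `∂h/∂x^μ` of a function of `x` alone. -/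
def partialDeriv (μ : Fin 4) (h : E4 → ℝ) (x : E4) : ℝ := fderiv ℝ h x (basisVec μ)

/-- The partial derivative `∂f/∂x^μ` of a function of `(x, y)`. -/
def dX (μ : Fin 4) (f : E4 → E4 → ℝ) (x y : E4) : ℝ := partialDeriv μ (fun x' => f x' y) x

/-- The partial derivative `∂f/∂y^μ` of a function of `(x, y)`. -/
def dY (μ : Fin 4) (f : E4 → E4 → ℝ) (x y : E4) : ℝ := partialDeriv μ (f x) y

/-! ## Finsler geometry of a function `F (x, y)` -/

/-- The fundamental tensor `g_{μν} = ∂̄_μ ∂̄_ν (F² / 2)`. -/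
def fundamentalTensor (F : E4 → E4 → ℝ) (x y : E4) : Matrix (Fin 4) (Fin 4) ℝ :=
  Matrix.of fun μ ν => dY μ (dY ν fun x' y' => F x' y' ^ 2 / 2) x y

/-- The components `g^{μν}` of the inverse of the fundamental tensor. -/
def inverseFundamentalTensor (F : E4 → E4 → ℝ) (x y : E4) : Matrix (Fin 4) (Fin 4) ℝ :=
  (fundamentalTensor F x y)⁻¹

/-- The coefficients of the Cartan nonlinear connection,
`N^ρ_μ = ¼ ∂̄_μ (g^{ρσ} (y^ν ∂_ν ∂̄_σ F² - ∂_σ F²))`. -/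
def cartanConnection (F : E4 → E4 → ℝ) (ρ μ : Fin 4) (x y : E4) : ℝ :=
  1 / 4 * dY μ (fun x' y' => ∑ σ, inverseFundamentalTensor F x' y' ρ σ *
    ((∑ ν, y' ν * dX ν (dY σ fun x'' y'' => F x'' y'' ^ 2) x' y')
      - dX σ (fun x'' y'' => F x'' y'' ^ 2) x' y')) x y

/-- The horizontal derivative `δ_μ f = ∂_μ f - N^ρ_μ ∂̄_ρ f`. -/
def horizontalDeriv (F : E4 → E4 → ℝ) (μ : Fin 4) (f : E4 → E4 → ℝ) (x y : E4) : ℝ :=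
  dX μ f x y - ∑ ρ, cartanConnection F ρ μ x y * dY ρ f x y

/-- The curvature `R^ρ_{μν} = δ_μ N^ρ_ν - δ_ν N^ρ_μ` of the Cartan nonlinear connection. -/
def nonlinearCurvature (F : E4 → E4 → ℝ) (ρ μ ν : Fin 4) (x y : E4) : ℝ :=
  horizontalDeriv F μ (cartanConnection F ρ ν) x y
    - horizontalDeriv F ν (cartanConnection F ρ μ) x y

/-- The Finsler Ricci scalar `Ric = R^ρ_{ρμ} y^μ`. -/
def finslerRicciScalar (F : E4 → E4 → ℝ) (x y : E4) : ℝ :=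
  ∑ ρ, ∑ μ, nonlinearCurvature F ρ ρ μ x y * y μ

/-- The Finsler Ricci tensor `R_{μν} = ½ ∂̄_μ ∂̄_ν Ric`. -/
def finslerRicciTensor (F : E4 → E4 → ℝ) (μ ν : Fin 4) (x y : E4) : ℝ :=
  1 / 2 * dY μ (dY ν (finslerRicciScalar F)) x y

/-! ## Pseudo-Riemannian geometry of a matrix function `a_{μν}(x)` -/

/-- The Christoffel symbols
`Γ^ρ_{μν} = ½ a^{ρσ} (∂_μ a_{σν} + ∂_ν a_{σμ} - ∂_σ a_{μν})` of the Levi-Civita connection. -/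
def christoffel (a : E4 → Matrix (Fin 4) (Fin 4) ℝ) (ρ μ ν : Fin 4) (x : E4) : ℝ :=
  1 / 2 * ∑ σ, (a x)⁻¹ ρ σ *
    (partialDeriv μ (fun x' => a x' σ ν) x + partialDeriv ν (fun x' => a x' σ μ) x
      - partialDeriv σ (fun x' => a x' μ ν) x)

/-- The Riemann tensor
`R_l^i_{jk} = ∂_j Γ^i_{kl} - ∂_k Γ^i_{jl} + Γ^i_{mj} Γ^m_{kl} - Γ^i_{mk} Γ^m_{jl}`. -/
def riemannTensor (a : E4 → Matrix (Fin 4) (Fin 4) ℝ) (l i j k : Fin 4) (x : E4) : ℝ :=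
  partialDeriv j (christoffel a i k l) x - partialDeriv k (christoffel a i j l) x
    + ∑ m, (christoffel a i m j x * christoffel a m k l x
      - christoffel a i m k x * christoffel a m j l x)

/-- The Ricci tensor `R_{lk} = R_l^i_{ik}`. -/
def ricciTensor (a : E4 → Matrix (Fin 4) (Fin 4) ℝ) (l k : Fin 4) (x : E4) : ℝ :=
  ∑ i, riemannTensor a l i i k x

/-- The covariant derivative `∇_μ b_ν = ∂_μ b_ν - Γ^ρ_{μν} b_ρ` of a 1-form. -/
def covariantDeriv (a : E4 → Matrix (Fin 4) (Fin 4) ℝ) (b : Fin 4 → E4 → ℝ) (μ ν : Fin 4)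
    (x : E4) : ℝ :=
  partialDeriv μ (b ν) x - ∑ ρ, christoffel a ρ μ ν x * b ρ x

/-- The Minkowski matrix `diag(-1, 1, 1, 1)`. -/
def minkowski : Matrix (Fin 4) (Fin 4) ℝ := Matrix.diagonal ![-1, 1, 1, 1]

/-- A matrix of Lorentzian signature: congruent to `diag(-1, 1, 1, 1)` or to its negative
(for example, the fundamental tensor of `F = √|A|` with `A` Lorentzian has signature `(-, +, +, +)`
where `A > 0` and `(+, -, -, -)` where `A < 0`). -/
def IsLorentzian (g : Matrix (Fin 4) (Fin 4) ℝ) : Prop :=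
  ∃ P : Matrix (Fin 4) (Fin 4) ℝ, IsUnit P.det ∧
    (P.transpose * g * P = minkowski ∨ P.transpose * g * P = -minkowski)

/-! ## Objects on a four-dimensional manifold -/

section Manifold

variable {M : Type*} [TopologicalSpace M] [ChartedSpace E4 M]

/-- The tangent vector `y^μ ∂_μ` at the point with coordinates `x` in the chart `e`. -/
def coordVector (e : OpenPartialHomeomorph M E4) (x y : E4) : TangentBundle (𝓡 4) M :=
  ⟨e.symm x, mfderiv (𝓡 4) (𝓡 4) e.symm x y⟩

/-- A function on the tangent bundle in the coordinates `(x, y)` induced by the chart `e`. -/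
def inCoords (e : OpenPartialHomeomorph M E4) (F : TangentBundle (𝓡 4) M → ℝ) (x y : E4) : ℝ :=
  F (coordVector e x y)

variable [IsManifold (𝓡 4) ∞ M]

variable (M) in
/-- A smooth pseudo-Riemannian metric, of any signature. -/
structure PseudoRiemannianMetric where
  /-- the bilinear form on each tangent space -/
  val (p : M) : TangentSpace (𝓡 4) p →L[ℝ] TangentSpace (𝓡 4) p →L[ℝ] ℝ
  symm (p : M) (v w : TangentSpace (𝓡 4) p) : val p v w = val p w v
  nondegenerate (p : M) (v : TangentSpace (𝓡 4) p) (hv : ∀ w, val p v w = 0) : v = 0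
  smooth : ContMDiff (𝓡 4) ((𝓡 4).prod 𝓘(ℝ, E4 →L[ℝ] E4 →L[ℝ] ℝ)) ∞
    fun p => Bundle.TotalSpace.mk' (E4 →L[ℝ] E4 →L[ℝ] ℝ)
      (E := fun p : M => TangentSpace (𝓡 4) p →L[ℝ] TangentSpace (𝓡 4) p →L[ℝ] ℝ) p (val p)

variable (M) in
/-- A smooth 1-form. -/
structure OneForm where
  /-- the linear form on each tangent space -/
  val (p : M) : TangentSpace (𝓡 4) p →L[ℝ] ℝ
  smooth : ContMDiff (𝓡 4) ((𝓡 4).prod 𝓘(ℝ, E4 →L[ℝ] ℝ)) ∞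
    fun p => Bundle.TotalSpace.mk' (E4 →L[ℝ] ℝ)
      (E := fun p : M => TangentSpace (𝓡 4) p →L[ℝ] ℝ) p (val p)

variable (M) in
/-- A Finsler spacetime structure: a conic subbundle `domain` (`𝒜`) of `TM ∖ 0` with non-empty
fibers, and a smooth Finsler metric `F` on it. The values of `F` off `𝒜` carry no meaning. -/
structure FinslerSpacetime where
  /-- the conic subbundle `𝒜` -/
  domain : Set (TangentBundle (𝓡 4) M)
  /-- the Finsler metric -/
  F : TangentBundle (𝓡 4) M → ℝ
  isOpen_domain : IsOpen domain
  ne_zero (p : M) (v : TangentSpace (𝓡 4) p) (hv : (⟨p, v⟩ : TangentBundle (𝓡 4) M) ∈ domain) :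
    v ≠ 0
  smul_mem (p : M) (v : TangentSpace (𝓡 4) p) (hv : (⟨p, v⟩ : TangentBundle (𝓡 4) M) ∈ domain)
    (c : ℝ) (hc : 0 < c) : (⟨p, c • v⟩ : TangentBundle (𝓡 4) M) ∈ domain
  exists_mem (p : M) : ∃ v : TangentSpace (𝓡 4) p, (⟨p, v⟩ : TangentBundle (𝓡 4) M) ∈ domain
  smooth : ContMDiffOn (𝓡 4).tangent 𝓘(ℝ, ℝ) ∞ F domain
  homogeneous (p : M) (v : TangentSpace (𝓡 4) p)
    (hv : (⟨p, v⟩ : TangentBundle (𝓡 4) M) ∈ domain) (c : ℝ) (hc : 0 < c) :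
    F ⟨p, c • v⟩ = c * F ⟨p, v⟩
  lorentzian (e : OpenPartialHomeomorph M E4) (he : e ∈ IsManifold.maximalAtlas (𝓡 4) ∞ M)
    (x y : E4) (hx : x ∈ e.target) (hy : coordVector e x y ∈ domain) :
    IsLorentzian (fundamentalTensor (inCoords e F) x y)

/-- The components `a_{μν}(x)` in the chart `e`. -/
def PseudoRiemannianMetric.components (a : PseudoRiemannianMetric M)
    (e : OpenPartialHomeomorph M E4) (x : E4) : Matrix (Fin 4) (Fin 4) ℝ :=
  Matrix.of fun μ ν => a.val (e.symm x) (mfderiv (𝓡 4) (𝓡 4) e.symm x (basisVec μ))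
    (mfderiv (𝓡 4) (𝓡 4) e.symm x (basisVec ν))

/-- The components `b_μ(x)` in the chart `e`. -/
def OneForm.components (b : OneForm M) (e : OpenPartialHomeomorph M E4) (μ : Fin 4) (x : E4) : ℝ :=
  b.val (e.symm x) (mfderiv (𝓡 4) (𝓡 4) e.symm x (basisVec μ))

/-- Einstein's vacuum equation: in every chart, the Ricci tensor vanishes. -/
def PseudoRiemannianMetric.IsEinsteinVacuum (a : PseudoRiemannianMetric M) : Prop :=
  ∀ e ∈ IsManifold.maximalAtlas (𝓡 4) ∞ M, ∀ x ∈ e.target, ∀ μ ν,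
    ricciTensor (a.components e) μ ν x = 0

/-- `b` is covariantly constant with respect to the Levi-Civita connection of `a`:
in every chart, `∇_μ b_ν = 0`. -/
def OneForm.IsCovariantlyConstant (b : OneForm M) (a : PseudoRiemannianMetric M) : Prop :=
  ∀ e ∈ IsManifold.maximalAtlas (𝓡 4) ∞ M, ∀ x ∈ e.target, ∀ μ ν,
    covariantDeriv (a.components e) (b.components e) μ ν x = 0

/-- The quadratic function `A(v) = a_{μν} v^μ v^ν`. -/
def PseudoRiemannianMetric.quad (a : PseudoRiemannianMetric M) (v : TangentBundle (𝓡 4) M) : ℝ :=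
  a.val v.1 v.2 v.2

/-- `α(v) = √|a_{μν} v^μ v^ν|`. -/
def PseudoRiemannianMetric.alpha (a : PseudoRiemannianMetric M) (v : TangentBundle (𝓡 4) M) : ℝ :=
  √|a.quad v|

/-- `β(v) = b_μ v^μ`. -/
def OneForm.beta (b : OneForm M) (v : TangentBundle (𝓡 4) M) : ℝ := b.val v.1 v.2

/-- `F` is an `(α, β)`-metric: it is constructed from `α` and `β` only. Different functions
of `(α, β)` are allowed in the regions where `A = a_{μν} y^μ y^ν` is positive, zero or negative
(as for `F = sgn(A) α + |β|`). No regularity of these functions is assumed. -/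
def FinslerSpacetime.IsAlphaBetaMetric (S : FinslerSpacetime M) (a : PseudoRiemannianMetric M)
    (b : OneForm M) : Prop :=
  ∃ Φ : SignType → ℝ → ℝ → ℝ, ∀ v ∈ S.domain,
    S.F v = Φ (SignType.sign (a.quad v)) (a.alpha v) (b.beta v)

/-- If `α ≠ 0` on `𝒜`, an `(α, β)`-metric is the same as a Finsler metric of the form
`F = α φ(β / α)`, with `φ` allowed to depend on the sign of `A`. -/
theorem FinslerSpacetime.isAlphaBetaMetric_iff (S : FinslerSpacetime M)
    (a : PseudoRiemannianMetric M) (b : OneForm M) (h0 : ∀ v ∈ S.domain, a.alpha v ≠ 0) :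
    S.IsAlphaBetaMetric a b ↔ ∃ φ : SignType → ℝ → ℝ, ∀ v ∈ S.domain,
      S.F v = a.alpha v * φ (SignType.sign (a.quad v)) (b.beta v / a.alpha v) := by
  constructor
  · rintro ⟨Φ, hΦ⟩
    refine ⟨fun s t => Φ s 1 t, ?_⟩
    rintro ⟨p, v⟩ hv
    have hpos : 0 < a.alpha ⟨p, v⟩ := lt_of_le_of_ne (Real.sqrt_nonneg _) (h0 _ hv).symm
    set c := (a.alpha ⟨p, v⟩)⁻¹ with hc
    have hcpos : 0 < c := inv_pos.mpr hpos
    have hq : a.quad ⟨p, c • v⟩ = c ^ 2 * a.quad ⟨p, v⟩ := by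
      simp only [PseudoRiemannianMetric.quad, map_smul, smul_apply,
        smul_eq_mul]
      ring
    have hα : a.alpha ⟨p, c • v⟩ = 1 := by
      have : a.alpha ⟨p, c • v⟩ = c * a.alpha ⟨p, v⟩ := by
        simp only [PseudoRiemannianMetric.alpha]
        rw [hq, abs_mul, abs_of_pos (pow_pos hcpos 2), Real.sqrt_mul (pow_pos hcpos 2).le,
          Real.sqrt_sq hcpos.le]
      rw [this, hc, inv_mul_cancel₀ hpos.ne']
    have hs : SignType.sign (a.quad ⟨p, c • v⟩) = SignType.sign (a.quad ⟨p, v⟩) := by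
      rw [hq, sign_mul, sign_pos (pow_pos hcpos 2), one_mul]
    have hβ : b.beta ⟨p, c • v⟩ = b.beta ⟨p, v⟩ / a.alpha ⟨p, v⟩ := by
      simp only [OneForm.beta, map_smul, smul_eq_mul]
      rw [hc, div_eq_inv_mul]
    have h1 := hΦ _ (S.smul_mem p v hv c hcpos)
    rw [S.homogeneous p v hv c hcpos, hs, hα, hβ] at h1
    change S.F ⟨p, v⟩ = a.alpha ⟨p, v⟩ *
      Φ (SignType.sign (a.quad ⟨p, v⟩)) 1 (b.beta ⟨p, v⟩ / a.alpha ⟨p, v⟩)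
    rw [← h1, hc, mul_inv_cancel_left₀ hpos.ne']
  · rintro ⟨φ, hφ⟩
    exact ⟨fun s r t => r * φ s (t / r), hφ⟩

/-- `F` is a Berwald metric: its Cartan nonlinear connection is linear, that is, in every chart
`N^ρ_μ(x, y) = Γ^ρ_{μν}(x) y^ν` on `𝒜` for some functions `Γ^ρ_{μν}` of `x`. -/
def FinslerSpacetime.IsBerwald (S : FinslerSpacetime M) : Prop :=
  ∀ e ∈ IsManifold.maximalAtlas (𝓡 4) ∞ M, ∃ Γ : Fin 4 → Fin 4 → Fin 4 → E4 → ℝ,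
    ∀ x ∈ e.target, ∀ y, coordVector e x y ∈ S.domain → ∀ ρ μ,
      cartanConnection (inCoords e S.F) ρ μ x y = ∑ ν, Γ ρ μ ν x * y ν

/-- The Pfeifer–Wohlfarth vacuum field equation of Finsler gravity, in the form that it takes for
Berwald metrics: `(F² g^{μν} - 3 y^μ y^ν) R_{μν} = 0` on `𝒜`, in every chart. -/
def FinslerSpacetime.SatisfiesBerwaldFieldEquation (S : FinslerSpacetime M) : Prop :=
  ∀ e ∈ IsManifold.maximalAtlas (𝓡 4) ∞ M, ∀ x ∈ e.target, ∀ y, coordVector e x y ∈ S.domain →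
    ∑ μ, ∑ ν, (inCoords e S.F x y ^ 2 * inverseFundamentalTensor (inCoords e S.F) x y μ ν
      - 3 * y μ * y ν) * finslerRicciTensor (inCoords e S.F) μ ν x y = 0

end Manifold

end FinslerGravity

end

/-!
Work in a chart, and let `Γ` be the Levi-Civita connection of `a`. Along the parallel transport of
`Γ` both `A = a_{μν} y^μ y^ν` and `β = b_μ y^μ` are constant, the first by metric compatibility
(`hasDerivAt_quad`), the second because `∇ b = 0` (`hasDerivAt_oneForm`). A function `F` of `α`, `β`
and the sign of `A` is therefore constant along parallel transport as well, with no regularity of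
its dependence on `α` and `β` needed; since `F` itself is smooth, this means
`∂_μ F = Γ^ρ_{μν} y^ν ∂̄_ρ F` (`dX_eq_of_dependsOn`).

Differentiating this relation for `F²` in the fibre direction gives
`y^ν ∂_ν ∂̄_σ F² - ∂_σ F² = 2 g_{σρ} Γ^ρ_{νκ} y^ν y^κ`, as the first-order terms cancel by the symmetry
of `Γ`. Since `g` is invertible, the Cartan nonlinear connection is `N^ρ_μ = Γ^ρ_{μν} y^ν`
(`cartanConnection_eq`), so `F` is Berwald. The curvature of `N` is then the Riemann tensor of `a`
contracted with `y`, hence `Ric` is the Ricci tensor of `a` evaluated on `(y, y)`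
(`finslerRicciScalar_eq`). It vanishes on the open set `𝒜`, so its fibre derivatives `R_{μν}` vanish
there, and the field equation holds.
-/

namespace FinslerGravity

open Function Topology Filter

/-! ### Partial derivatives in induced coordinates -/

theorem hasFDerivAt_coord (i : Fin 4) (y : E4) :
    HasFDerivAt (fun y : E4 => y i) (EuclideanSpace.proj (𝕜 := ℝ) i : E4 →L[ℝ] ℝ) y :=
  (EuclideanSpace.proj (𝕜 := ℝ) i : E4 →L[ℝ] ℝ).hasFDerivAt

theorem basisVec_apply (μ i : Fin 4) : basisVec μ i = if i = μ then 1 else 0 := by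
  simp [basisVec]

theorem eq_sum_basisVec (y : E4) : y = ∑ i, y i • basisVec i := by
  ext j
  simp [basisVec_apply]

theorem linear_eq_sum_basisVec (ℓ : E4 →L[ℝ] ℝ) (y : E4) : ℓ y = ∑ i, ℓ (basisVec i) * y i := by
  conv_lhs => rw [eq_sum_basisVec y]
  simp [mul_comm]

theorem bilinear_eq_sum_basisVec (B : E4 →L[ℝ] E4 →L[ℝ] ℝ) (u y : E4) :
    B u y = ∑ i, ∑ j, B (basisVec i) (basisVec j) * (u i * y j) := by
  rw [← ContinuousLinearMap.flip_apply B u y, linear_eq_sum_basisVec (B.flip y) u]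
  refine Finset.sum_congr rfl fun i _ => ?_
  rw [ContinuousLinearMap.flip_apply, linear_eq_sum_basisVec (B (basisVec i)) y, Finset.sum_mul]
  exact Finset.sum_congr rfl fun j _ => by ring

section Calculus

variable {f g : E4 → E4 → ℝ} {x y : E4} {D : Set (E4 × E4)}

theorem dX_eq_fderiv (hf : DifferentiableAt ℝ (uncurry f) (x, y)) (μ : Fin 4) :
    dX μ f x y = fderiv ℝ (uncurry f) (x, y) (basisVec μ, 0) := by
  have h : HasFDerivAt (fun x' : E4 => (x', y)) (ContinuousLinearMap.inl ℝ E4 E4) x :=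
    hasFDerivAt_prodMk_left x y
  have := (hf.hasFDerivAt.comp x h).fderiv
  rw [dX, partialDeriv]
  change fderiv ℝ (uncurry f ∘ fun x' : E4 => (x', y)) x _ = _
  rw [this]; simp

theorem dY_eq_fderiv (hf : DifferentiableAt ℝ (uncurry f) (x, y)) (μ : Fin 4) :
    dY μ f x y = fderiv ℝ (uncurry f) (x, y) (0, basisVec μ) := by
  have h : HasFDerivAt (fun y' : E4 => (x, y')) (ContinuousLinearMap.inr ℝ E4 E4) y :=
    hasFDerivAt_prodMk_right x y
  have := (hf.hasFDerivAt.comp y h).fderiv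
  rw [dY, partialDeriv]
  change fderiv ℝ (uncurry f ∘ fun y' : E4 => (x, y')) y _ = _
  rw [this]; simp

theorem partialDeriv_congr {U : Set E4} (hU : IsOpen U) {h k : E4 → ℝ} (hhk : Set.EqOn h k U)
    (hx : x ∈ U) (μ : Fin 4) : partialDeriv μ h x = partialDeriv μ k x := by
  rw [partialDeriv, partialDeriv,
    (hhk.eventuallyEq_of_mem (hU.mem_nhds hx)).fderiv_eq]

theorem dX_congr (hD : IsOpen D) (h : ∀ x y, (x, y) ∈ D → f x y = g x y) (hxy : (x, y) ∈ D)
    (μ : Fin 4) : dX μ f x y = dX μ g x y :=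
  partialDeriv_congr (hD.preimage (Continuous.prodMk_left y)) (fun x' hx' => h x' y hx') hxy μ

theorem dY_congr (hD : IsOpen D) (h : ∀ x y, (x, y) ∈ D → f x y = g x y) (hxy : (x, y) ∈ D)
    (μ : Fin 4) : dY μ f x y = dY μ g x y :=
  partialDeriv_congr (hD.preimage (Continuous.prodMk_right x)) (fun y' hy' => h x y' hy') hxy μ

theorem contDiffOn_dY (hD : IsOpen D) (hf : ContDiffOn ℝ ∞ (uncurry f) D) (μ : Fin 4) :
    ContDiffOn ℝ ∞ (uncurry (dY μ f)) D := by
  have h := (hf.fderiv_of_isOpen hD (m := ∞) (by simp)).clm_apply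
    (contDiffOn_const (c := ((0, basisVec μ) : E4 × E4)))
  refine h.congr fun z hz => ?_
  exact dY_eq_fderiv ((hf.contDiffAt (hD.mem_nhds hz)).differentiableAt (by simp)) μ

/-- Schwarz's theorem in induced coordinates. -/
theorem dX_dY_comm (hD : IsOpen D) (hf : ContDiffOn ℝ ∞ (uncurry f) D) (hxy : (x, y) ∈ D)
    (μ ν : Fin 4) : dX μ (dY ν f) x y = dY ν (dX μ f) x y := by
  have hdiff : ∀ z ∈ D, DifferentiableAt ℝ (uncurry f) z := fun z hz =>
    (hf.contDiffAt (hD.mem_nhds hz)).differentiableAt (by simp)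
  have hc := hf.contDiffAt (hD.mem_nhds hxy)
  have h2 : DifferentiableAt ℝ (fderiv ℝ (uncurry f)) (x, y) :=
    ((hf.fderiv_of_isOpen hD (m := ∞) (by simp)).contDiffAt
      (hD.mem_nhds hxy)).differentiableAt (by simp)
  have key : ∀ v : E4 × E4, ∀ w : E4 × E4,
      fderiv ℝ (fun z => fderiv ℝ (uncurry f) z v) (x, y) w
        = fderiv ℝ (fderiv ℝ (uncurry f)) (x, y) w v := by
    intro v w
    rw [fderiv_clm_apply h2 (differentiableAt_const v)]
    simp
  rw [dX_congr hD (g := fun x y => fderiv ℝ (uncurry f) (x, y) (0, basisVec ν))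
      (fun x y h => dY_eq_fderiv (hdiff _ h) ν) hxy,
    dY_congr hD (g := fun x y => fderiv ℝ (uncurry f) (x, y) (basisVec μ, 0))
      (fun x y h => dX_eq_fderiv (hdiff _ h) μ) hxy,
    dX_eq_fderiv (f := fun x y => fderiv ℝ (uncurry f) (x, y) (0, basisVec ν))
      (h2.clm_apply (differentiableAt_const ((0, basisVec ν) : E4 × E4))),
    dY_eq_fderiv (f := fun x y => fderiv ℝ (uncurry f) (x, y) (basisVec μ, 0))
      (h2.clm_apply (differentiableAt_const ((basisVec μ, 0) : E4 × E4)))]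
  change fderiv ℝ (fun z => fderiv ℝ (uncurry f) z _) (x, y) _
    = fderiv ℝ (fun z => fderiv ℝ (uncurry f) z _) (x, y) _
  rw [key, key]
  exact (contDiffAt_infty.mp hc 2).isSymmSndFDerivAt (by simp) _ _

end Calculus

/-! ### Partial derivatives of sums, linear forms and quadratic forms -/

theorem partialDeriv_const_mul (c : ℝ) (h : E4 → ℝ) (μ : Fin 4) (y : E4) :
    partialDeriv μ (fun y => c * h y) y = c * partialDeriv μ h y := by
  have e : (fun y => c * h y) = c • h := rfl
  rw [partialDeriv, e, fderiv_const_smul_field]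
  rfl

theorem partialDeriv_linear (c : Fin 4 → ℝ) (μ : Fin 4) (y : E4) :
    partialDeriv μ (fun y : E4 => ∑ ν, c ν * y ν) y = c μ := by
  have h := HasFDerivAt.fun_sum (u := Finset.univ) fun ν _ => (hasFDerivAt_coord ν y).const_mul (c ν)
  rw [partialDeriv, h.fderiv]
  simp [basisVec_apply]

theorem partialDeriv_quadratic (c : Fin 4 → Fin 4 → ℝ) (hc : ∀ ν κ, c ν κ = c κ ν) (μ : Fin 4)
    (y : E4) :
    partialDeriv μ (fun y : E4 => ∑ ν, ∑ κ, c ν κ * (y ν * y κ)) y = 2 * ∑ ν, c μ ν * y ν := by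
  have h := HasFDerivAt.fun_sum (u := Finset.univ) fun ν _ =>
    HasFDerivAt.fun_sum (u := Finset.univ) fun κ _ =>
      ((hasFDerivAt_coord ν y).fun_mul (hasFDerivAt_coord κ y)).const_mul (c ν κ)
  rw [partialDeriv, h.fderiv]
  simp [basisVec_apply, Finset.sum_add_distrib, two_mul]
  exact Finset.sum_congr rfl fun ν _ => by rw [hc]

theorem partialDeriv_sum_mul_const (c : Fin 4 → E4 → ℝ) (k : Fin 4 → ℝ) (μ : Fin 4) (x : E4)
    (hc : ∀ ν, DifferentiableAt ℝ (c ν) x) :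
    partialDeriv μ (fun x => ∑ ν, c ν x * k ν) x = ∑ ν, partialDeriv μ (c ν) x * k ν := by
  have h := HasFDerivAt.fun_sum (u := Finset.univ) fun ν _ => (hc ν).hasFDerivAt.mul_const (k ν)
  rw [partialDeriv, h.fderiv]
  simp [partialDeriv, mul_comm]

/-! ### The Levi-Civita connection in a chart -/

section LeviCivita

variable {a : E4 → Matrix (Fin 4) (Fin 4) ℝ} {U : Set E4} {x : E4}

theorem contDiffOn_partialDeriv (hU : IsOpen U) {h : E4 → ℝ} (hh : ContDiffOn ℝ ∞ h U)
    (μ : Fin 4) : ContDiffOn ℝ ∞ (partialDeriv μ h) U :=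
  (hh.fderiv_of_isOpen hU (m := ∞) (by simp)).clm_apply contDiffOn_const

theorem contDiffOn_det {n : ℕ} {m : E4 → Matrix (Fin n) (Fin n) ℝ}
    (hm : ∀ i j, ContDiffOn ℝ ∞ (fun x => m x i j) U) :
    ContDiffOn ℝ ∞ (fun x => (m x).det) U := by
  simp only [Matrix.det_apply']
  exact ContDiffOn.sum fun σ _ => contDiffOn_const.mul (contDiffOn_prod fun i _ => hm _ _)

theorem contDiffOn_inv_apply (ha : ∀ i j, ContDiffOn ℝ ∞ (fun x => a x i j) U)
    (hdet : ∀ x ∈ U, IsUnit (a x).det) (i j : Fin 4) :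
    ContDiffOn ℝ ∞ (fun x => (a x)⁻¹ i j) U := by
  simp only [Matrix.inv_def, Matrix.smul_apply, Ring.inverse_eq_inv', smul_eq_mul]
  refine ((contDiffOn_det ha).inv fun x hx => (hdet x hx).ne_zero).mul ?_
  simp only [Matrix.adjugate_apply]
  refine contDiffOn_det fun k l => ?_
  by_cases h : k = j
  · subst h; simpa using contDiffOn_const
  · simpa [Matrix.updateRow_ne h] using ha k l

theorem contDiffOn_christoffel (hU : IsOpen U)
    (ha : ∀ i j, ContDiffOn ℝ ∞ (fun x => a x i j) U)
    (hdet : ∀ x ∈ U, IsUnit (a x).det) (ρ μ ν : Fin 4) :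
    ContDiffOn ℝ ∞ (christoffel a ρ μ ν) U := by
  unfold christoffel
  exact contDiffOn_const.mul (ContDiffOn.sum fun σ _ => (contDiffOn_inv_apply ha hdet ρ σ).mul
    (((contDiffOn_partialDeriv hU (ha _ _) _).add (contDiffOn_partialDeriv hU (ha _ _) _)).sub
      (contDiffOn_partialDeriv hU (ha _ _) _)))

theorem partialDeriv_symm (hU : IsOpen U) (hsymm : ∀ x ∈ U, ∀ i j, a x i j = a x j i)
    (hx : x ∈ U) (μ i j : Fin 4) :
    partialDeriv μ (fun x => a x i j) x = partialDeriv μ (fun x => a x j i) x :=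
  partialDeriv_congr hU (fun x hx => hsymm x hx i j) hx μ

theorem christoffel_symm (hU : IsOpen U) (hsymm : ∀ x ∈ U, ∀ i j, a x i j = a x j i)
    (hx : x ∈ U) (ρ μ ν : Fin 4) : christoffel a ρ μ ν x = christoffel a ρ ν μ x := by
  unfold christoffel
  congr 1
  refine Finset.sum_congr rfl fun σ _ => ?_
  rw [partialDeriv_symm hU hsymm hx σ μ ν]
  ring

/-- Lowering the upper index gives the Christoffel symbols of the first kind. -/
theorem sum_mul_christoffel (hdet : IsUnit (a x).det) (κ μ ν : Fin 4) :
    ∑ ρ, a x κ ρ * christoffel a ρ μ ν x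
      = 1 / 2 * (partialDeriv μ (fun x' => a x' κ ν) x + partialDeriv ν (fun x' => a x' κ μ) x
        - partialDeriv κ (fun x' => a x' μ ν) x) := by
  set w : Fin 4 → ℝ := fun σ => 1 / 2 * (partialDeriv μ (fun x' => a x' σ ν) x
    + partialDeriv ν (fun x' => a x' σ μ) x - partialDeriv σ (fun x' => a x' μ ν) x) with hw
  have h1 : (fun ρ => christoffel a ρ μ ν x) = (a x)⁻¹.mulVec w := by
    ext ρ
    simp only [christoffel, Matrix.mulVec, dotProduct, Finset.mul_sum, hw]
    exact Finset.sum_congr rfl fun σ _ => by ring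
  have h2 : (a x).mulVec (fun ρ => christoffel a ρ μ ν x) = w := by
    rw [h1, Matrix.mulVec_mulVec, Matrix.mul_nonsing_inv _ hdet, Matrix.one_mulVec]
  exact congrFun h2 κ

/-- Metric compatibility of the Levi-Civita connection: `∇_μ a_{κν} = 0`. -/
theorem partialDeriv_eq_christoffel (hU : IsOpen U) (hsymm : ∀ x ∈ U, ∀ i j, a x i j = a x j i)
    (hx : x ∈ U) (hdet : IsUnit (a x).det) (μ κ ν : Fin 4) :
    partialDeriv μ (fun x' => a x' κ ν) x
      = ∑ ρ, (a x κ ρ * christoffel a ρ μ ν x + a x ν ρ * christoffel a ρ μ κ x) := by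
  rw [Finset.sum_add_distrib, sum_mul_christoffel hdet, sum_mul_christoffel hdet,
    partialDeriv_symm hU hsymm hx μ ν κ, partialDeriv_symm hU hsymm hx ν κ μ,
    partialDeriv_symm hU hsymm hx κ ν μ]
  ring

end LeviCivita

/-! ### The Cartan connection of a horizontally constant Finsler function -/

section Spray

variable {F : E4 → E4 → ℝ} {D : Set (E4 × E4)} {Γ : Fin 4 → Fin 4 → Fin 4 → E4 → ℝ} {x y : E4}

theorem dX_sq (hF : DifferentiableAt ℝ (uncurry F) (x, y)) (μ : Fin 4) :
    dX μ (fun x y => F x y ^ 2) x y = 2 * F x y * dX μ F x y := by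
  rw [dX_eq_fderiv (f := fun x y => F x y ^ 2) (hF.fun_pow 2), dX_eq_fderiv hF]
  change fderiv ℝ (fun z => uncurry F z ^ 2) (x, y) _ = _
  rw [fderiv_fun_pow 2 hF]; simp

theorem dY_sq (hF : DifferentiableAt ℝ (uncurry F) (x, y)) (μ : Fin 4) :
    dY μ (fun x y => F x y ^ 2) x y = 2 * F x y * dY μ F x y := by
  rw [dY_eq_fderiv (f := fun x y => F x y ^ 2) (hF.fun_pow 2), dY_eq_fderiv hF]
  change fderiv ℝ (fun z => uncurry F z ^ 2) (x, y) _ = _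
  rw [fderiv_fun_pow 2 hF]; simp

theorem fundamentalTensor_apply (F : E4 → E4 → ℝ) (x y : E4) (μ ν : Fin 4) :
    fundamentalTensor F x y μ ν = 1 / 2 * dY μ (dY ν fun x y => F x y ^ 2) x y := by
  have h1 : (dY ν fun x y => F x y ^ 2 / 2)
      = fun x y => 1 / 2 * dY ν (fun x y => F x y ^ 2) x y := by
    ext x y
    simp only [dY, div_eq_inv_mul, mul_one, partialDeriv_const_mul]
  rw [fundamentalTensor, Matrix.of_apply, h1, dY, dY, partialDeriv_const_mul]

/-- The mixed second derivatives of a function annihilated by the horizontal derivatives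
`∂_ν - Γ^ρ_{νκ} y^κ ∂̄_ρ`. -/
theorem dX_dY_of_horizontal (hD : IsOpen D) {L : E4 → E4 → ℝ} (hL : ContDiffOn ℝ ∞ (uncurry L) D)
    (h : ∀ x y, (x, y) ∈ D → ∀ μ, dX μ L x y = ∑ ρ, (∑ ν, Γ ρ μ ν x * y ν) * dY ρ L x y)
    (hxy : (x, y) ∈ D) (ν σ : Fin 4) :
    dX ν (dY σ L) x y
      = ∑ ρ, (Γ ρ ν σ x * dY ρ L x y + (∑ κ, Γ ρ ν κ x * y κ) * dY σ (dY ρ L) x y) := by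
  rw [dX_dY_comm hD hL hxy, dY_congr hD (fun x y h' => h x y h' ν) hxy]
  have hd : ∀ ρ, DifferentiableAt ℝ (dY ρ L x) y := fun ρ =>
    DifferentiableAt.comp (g := uncurry (dY ρ L)) (f := fun y => (x, y)) y
      (((contDiffOn_dY hD hL ρ).contDiffAt (hD.mem_nhds hxy)).differentiableAt (by simp))
      (hasFDerivAt_prodMk_right x y).differentiableAt
  have hl : ∀ ρ, DifferentiableAt ℝ (fun y : E4 => ∑ κ, Γ ρ ν κ x * y κ) y := fun ρ => by fun_prop
  have hs := HasFDerivAt.fun_sum (u := Finset.univ) fun ρ _ =>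
    (hl ρ).hasFDerivAt.fun_mul (hd ρ).hasFDerivAt
  have hlin : ∀ ρ, fderiv ℝ (fun y : E4 => ∑ κ, Γ ρ ν κ x * y κ) y (basisVec σ) = Γ ρ ν σ x :=
    fun ρ => partialDeriv_linear _ _ _
  conv_lhs => rw [dY, partialDeriv, hs.fderiv]
  simp [hlin]
  refine Finset.sum_congr rfl fun ρ _ => ?_
  simp only [dY, partialDeriv]
  ring

/-- If a regular Finsler function is annihilated by the horizontal derivatives of a symmetric
affine connection `Γ`, then the spray bracket is `2 g_{σρ} Γ^ρ_{νκ} y^ν y^κ`, and the Cartan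
nonlinear connection is `Γ`. -/
theorem cartanConnection_eq (hD : IsOpen D) (hF : ContDiffOn ℝ ∞ (uncurry F) D)
    (hreg : ∀ x y, (x, y) ∈ D → IsUnit (fundamentalTensor F x y).det)
    (hΓ : ∀ x y, (x, y) ∈ D → ∀ ρ μ ν, Γ ρ μ ν x = Γ ρ ν μ x)
    (h : ∀ x y, (x, y) ∈ D → ∀ μ, dX μ F x y = ∑ ρ, (∑ ν, Γ ρ μ ν x * y ν) * dY ρ F x y)
    (hxy : (x, y) ∈ D) (ρ μ : Fin 4) :
    cartanConnection F ρ μ x y = ∑ ν, Γ ρ μ ν x * y ν := by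
  set L : E4 → E4 → ℝ := fun x y => F x y ^ 2
  have hL : ContDiffOn ℝ ∞ (uncurry L) D := hF.pow 2
  have hdF : ∀ x y, (x, y) ∈ D → DifferentiableAt ℝ (uncurry F) (x, y) := fun x y hz =>
    (hF.contDiffAt (hD.mem_nhds hz)).differentiableAt (by simp)
  have hhL : ∀ x y, (x, y) ∈ D → ∀ μ,
      dX μ L x y = ∑ ρ, (∑ ν, Γ ρ μ ν x * y ν) * dY ρ L x y := by
    intro x y hz μ
    rw [dX_sq (hdF x y hz), h x y hz, Finset.mul_sum]
    refine Finset.sum_congr rfl fun ρ _ => ?_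
    rw [dY_sq (hdF x y hz)]; ring
  have hbr : ∀ x y, (x, y) ∈ D → ∀ σ, (∑ ν, y ν * dX ν (dY σ L) x y) - dX σ L x y
      = ∑ τ, fundamentalTensor F x y σ τ * (2 * ∑ ν, ∑ κ, Γ τ ν κ x * (y ν * y κ)) := by
    intro x y hz σ
    -- The terms with first derivatives of `L` cancel because `Γ` is symmetric.
    simp only [dX_dY_of_horizontal hD hL hhL hz, hhL x y hz, fundamentalTensor_apply,
      Finset.sum_add_distrib, mul_add]
    have e1 : ∑ ν, y ν * ∑ τ, Γ τ ν σ x * dY τ L x y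
        = ∑ τ, (∑ ν, Γ τ σ ν x * y ν) * dY τ L x y := by
      simp only [Finset.mul_sum, Finset.sum_mul]
      rw [Finset.sum_comm]
      refine Finset.sum_congr rfl fun τ _ => Finset.sum_congr rfl fun ν _ => ?_
      rw [hΓ x y hz τ ν σ]; ring
    have e2 : ∑ ν, y ν * ∑ τ, (∑ κ, Γ τ ν κ x * y κ) * dY σ (dY τ L) x y
        = ∑ τ, 1 / 2 * dY σ (dY τ L) x y * (2 * ∑ ν, ∑ κ, Γ τ ν κ x * (y ν * y κ)) := by
      simp only [Finset.mul_sum, Finset.sum_mul]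
      rw [Finset.sum_comm]
      refine Finset.sum_congr rfl fun τ _ => Finset.sum_congr rfl fun ν _ =>
        Finset.sum_congr rfl fun κ _ => ?_
      ring
    rw [e1, e2]; ring
  have hspray : ∀ x y, (x, y) ∈ D → (∑ σ, inverseFundamentalTensor F x y ρ σ *
      ((∑ ν, y ν * dX ν (dY σ L) x y) - dX σ L x y))
      = 2 * ∑ ν, ∑ κ, Γ ρ ν κ x * (y ν * y κ) := by
    intro x y hz
    set w : Fin 4 → ℝ := fun τ => 2 * ∑ ν, ∑ κ, Γ τ ν κ x * (y ν * y κ) with hw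
    have e : (fundamentalTensor F x y)⁻¹.mulVec ((fundamentalTensor F x y).mulVec w) = w := by
      rw [Matrix.mulVec_mulVec, Matrix.nonsing_inv_mul _ (hreg x y hz), Matrix.one_mulVec]
    simp only [hbr x y hz]
    exact congrFun e ρ
  rw [cartanConnection, dY_congr hD hspray hxy, dY, partialDeriv_const_mul,
    partialDeriv_quadratic (fun ν κ => Γ ρ ν κ x) (fun ν κ => hΓ x y hxy ρ ν κ)]
  ring

end Spray

/-! ### The curvature of a linear connection -/

section Curvature

variable {F : E4 → E4 → ℝ} {D : Set (E4 × E4)} {a : E4 → Matrix (Fin 4) (Fin 4) ℝ} {x y : E4}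

/-- If the Cartan nonlinear connection is the Levi-Civita connection of `a`, then the Finsler Ricci
scalar is the Ricci tensor of `a`, evaluated on `y`. -/
theorem finslerRicciScalar_eq (hD : IsOpen D)
    (hΓ : ∀ x y, (x, y) ∈ D → ∀ ρ μ ν, christoffel a ρ μ ν x = christoffel a ρ ν μ x)
    (hdiff : ∀ x y, (x, y) ∈ D → ∀ ρ μ ν, DifferentiableAt ℝ (christoffel a ρ μ ν) x)
    (hN : ∀ x y, (x, y) ∈ D → ∀ ρ μ,
      cartanConnection F ρ μ x y = ∑ ν, christoffel a ρ μ ν x * y ν)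
    (hxy : (x, y) ∈ D) :
    finslerRicciScalar F x y = ∑ μ, ∑ ν, ricciTensor a ν μ x * (y ν * y μ) := by
  have hH : ∀ ρ μ ν, horizontalDeriv F μ (cartanConnection F ρ ν) x y
      = ∑ κ, (partialDeriv μ (christoffel a ρ ν κ) x
        - ∑ σ, christoffel a σ μ κ x * christoffel a ρ σ ν x) * y κ := by
    intro ρ μ ν
    rw [horizontalDeriv, dX_congr hD (fun x y h => hN x y h ρ ν) hxy]
    simp only [dY_congr hD (fun x y h => hN x y h ρ ν) hxy, hN x y hxy]
    simp only [dX, dY, partialDeriv_linear]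
    rw [partialDeriv_sum_mul_const _ _ _ _ fun κ => hdiff x y hxy ρ ν κ]
    simp only [sub_mul, Finset.sum_sub_distrib, Finset.sum_mul]
    rw [Finset.sum_comm (s := Finset.univ (α := Fin 4))
      (f := fun κ σ => christoffel a σ μ κ x * christoffel a ρ σ ν x * y κ)]
    congr 1
    refine Finset.sum_congr rfl fun κ _ => Finset.sum_congr rfl fun σ _ => ?_
    rw [hΓ x y hxy ρ ν κ]; ring
  simp only [finslerRicciScalar, nonlinearCurvature, hH, ricciTensor, riemannTensor]
  rw [Finset.sum_comm]
  refine Finset.sum_congr rfl fun μ _ => ?_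
  simp only [Finset.sum_mul, ← Finset.sum_sub_distrib]
  rw [Finset.sum_comm]
  refine Finset.sum_congr rfl fun κ _ => Finset.sum_congr rfl fun ρ _ => ?_
  have e1 : ∑ σ, (christoffel a ρ σ ρ x * christoffel a σ μ κ x
      - christoffel a ρ σ μ x * christoffel a σ ρ κ x)
      = ∑ σ, christoffel a σ μ κ x * christoffel a ρ σ ρ x
        - ∑ σ, christoffel a σ ρ κ x * christoffel a ρ σ μ x := by
    rw [← Finset.sum_sub_distrib]
    exact Finset.sum_congr rfl fun σ _ => by ring
  rw [e1]; ring

end Curvature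

/-! ### Functions of `A` and `β` are horizontally constant -/

section Transport

variable {F : E4 → E4 → ℝ} {D : Set (E4 × E4)} {a : E4 → Matrix (Fin 4) (Fin 4) ℝ}
  {b : Fin 4 → E4 → ℝ} {U : Set E4} {x y : E4}

/-- The horizontal lift of `∂_μ` for the connection `Γ`, as a vector field in `(x, y)`. Its integral
curves are the parallel vector fields along the coordinate lines of `x^μ`. -/
noncomputable def horizontalLift (Γ : Fin 4 → Fin 4 → Fin 4 → E4 → ℝ) (μ : Fin 4) (z : E4 × E4) :
    E4 × E4 :=
  (basisVec μ, WithLp.toLp 2 fun ρ => -∑ ν, Γ ρ μ ν z.1 * z.2 ν)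

theorem fderiv_horizontalLift {Γ : Fin 4 → Fin 4 → Fin 4 → E4 → ℝ}
    (hF : DifferentiableAt ℝ (uncurry F) (x, y)) (μ : Fin 4) :
    fderiv ℝ (uncurry F) (x, y) (horizontalLift Γ μ (x, y))
      = dX μ F x y - ∑ ρ, (∑ ν, Γ ρ μ ν x * y ν) * dY ρ F x y := by
  have e : horizontalLift Γ μ (x, y)
      = (basisVec μ, 0) - ∑ ρ, (∑ ν, Γ ρ μ ν x * y ν) • ((0, basisVec ρ) : E4 × E4) := by
    have h2 := eq_sum_basisVec (WithLp.toLp 2 fun ρ => -∑ ν, Γ ρ μ ν x * y ν : E4)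
    rw [horizontalLift, h2]
    ext i <;> simp [Prod.fst_sum, Prod.snd_sum]
  simp only [e, map_sub, map_sum, map_smul, dX_eq_fderiv hF, dY_eq_fderiv hF, smul_eq_mul]

theorem contDiffAt_horizontalLift {Γ : Fin 4 → Fin 4 → Fin 4 → E4 → ℝ} (hU : IsOpen U)
    (hΓ : ∀ ρ μ ν, ContDiffOn ℝ ∞ (Γ ρ μ ν) U) (hx : x ∈ U) (μ : Fin 4) :
    ContDiffAt ℝ 1 (horizontalLift Γ μ) (x, y) := by
  refine contDiffAt_const.prodMk ?_
  rw [contDiffAt_euclidean]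
  intro ρ
  refine (ContDiffAt.sum fun ν _ => ContDiffAt.mul ?_ ?_).neg
  · exact (((hΓ ρ μ ν).contDiffAt (hU.mem_nhds hx)).of_le (by simp)).comp (x, y) contDiffAt_fst
  · exact ((EuclideanSpace.proj (𝕜 := ℝ) ν : E4 →L[ℝ] ℝ).contDiff.comp
      contDiff_snd).contDiffAt

/-- `A` is constant along parallel transport, by metric compatibility. -/
theorem hasDerivAt_quad (hU : IsOpen U) (ha : ∀ i j, ContDiffOn ℝ ∞ (fun x => a x i j) U)
    (hsymm : ∀ x ∈ U, ∀ i j, a x i j = a x j i) (hdet : ∀ x ∈ U, IsUnit (a x).det)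
    {γ : ℝ → E4 × E4} {t : ℝ} (hγU : (γ t).1 ∈ U) {μ : Fin 4}
    (hγ : HasDerivAt γ (horizontalLift (christoffel a) μ (γ t)) t) :
    HasDerivAt (fun t => ∑ i, ∑ j, a (γ t).1 i j * ((γ t).2 i * (γ t).2 j)) 0 t := by
  have h1 : HasDerivAt (fun t => (γ t).1) (basisVec μ) t := hγ.fst
  have h2 : ∀ i, HasDerivAt (fun t => (γ t).2 i)
      (-∑ ν, christoffel a i μ ν (γ t).1 * (γ t).2 ν) t := fun i =>
    HasFDerivAt.comp_hasDerivAt (f := fun t => (γ t).2) t (hasFDerivAt_coord i (γ t).2) hγ.snd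
  have h3 : ∀ i j, HasDerivAt (fun t => a (γ t).1 i j)
      (partialDeriv μ (fun x => a x i j) (γ t).1) t := fun i j =>
    HasFDerivAt.comp_hasDerivAt (f := fun t => (γ t).1) (l := fun x => a x i j) t
      (((ha i j).contDiffAt (hU.mem_nhds hγU)).differentiableAt (by simp)).hasFDerivAt h1
  have h := HasDerivAt.fun_sum (u := Finset.univ) fun i _ =>
    HasDerivAt.fun_sum (u := Finset.univ) fun j _ => (h3 i j).fun_mul ((h2 i).fun_mul (h2 j))
  refine h.congr_deriv ?_
  set p := (γ t).1
  set v := (γ t).2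
  simp only [partialDeriv_eq_christoffel hU hsymm hγU (hdet p hγU), Finset.sum_add_distrib,
    mul_add, add_mul, mul_neg, neg_mul, Finset.sum_neg_distrib, Finset.sum_mul, Finset.mul_sum]
  have e1 : ∑ i, ∑ j, ∑ ρ, a p i ρ * christoffel a ρ μ j p * (v i * v j)
      = ∑ i, ∑ j, ∑ ν, a p i j * (v i * (christoffel a j μ ν p * v ν)) := by
    refine Finset.sum_congr rfl fun i _ => ?_
    rw [Finset.sum_comm]
    refine Finset.sum_congr rfl fun j _ => Finset.sum_congr rfl fun ν _ => ?_
    ring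
  have e2 : ∑ i, ∑ j, ∑ ρ, a p j ρ * christoffel a ρ μ i p * (v i * v j)
      = ∑ i, ∑ j, ∑ ν, a p i j * (christoffel a i μ ν p * v ν * v j) := by
    rw [Finset.sum_comm (s := Finset.univ (α := Fin 4)) (t := Finset.univ (α := Fin 4))
      (f := fun i j => ∑ ν, a p i j * (christoffel a i μ ν p * v ν * v j))]
    rw [Finset.sum_comm]
    refine Finset.sum_congr rfl fun j _ => ?_
    rw [Finset.sum_comm]
    refine Finset.sum_congr rfl fun i _ => Finset.sum_congr rfl fun ν _ => ?_
    rw [hsymm p hγU i j]; ring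
  rw [e1, e2]; ring

/-- `β` is constant along parallel transport if `b` is covariantly constant. -/
theorem hasDerivAt_oneForm (hU : IsOpen U) (hb : ∀ i, ContDiffOn ℝ ∞ (b i) U)
    (hpar : ∀ x ∈ U, ∀ μ ν, covariantDeriv a b μ ν x = 0)
    {γ : ℝ → E4 × E4} {t : ℝ} (hγU : (γ t).1 ∈ U) {μ : Fin 4}
    (hγ : HasDerivAt γ (horizontalLift (christoffel a) μ (γ t)) t) :
    HasDerivAt (fun t => ∑ i, b i (γ t).1 * (γ t).2 i) 0 t := by
  have h1 : HasDerivAt (fun t => (γ t).1) (basisVec μ) t := hγ.fst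
  have h2 : ∀ i, HasDerivAt (fun t => (γ t).2 i)
      (-∑ ν, christoffel a i μ ν (γ t).1 * (γ t).2 ν) t := fun i =>
    HasFDerivAt.comp_hasDerivAt (f := fun t => (γ t).2) t (hasFDerivAt_coord i (γ t).2) hγ.snd
  have h3 : ∀ i, HasDerivAt (fun t => b i (γ t).1) (partialDeriv μ (b i) (γ t).1) t := fun i =>
    HasFDerivAt.comp_hasDerivAt (f := fun t => (γ t).1) t
      (((hb i).contDiffAt (hU.mem_nhds hγU)).differentiableAt (by simp)).hasFDerivAt h1
  have h := HasDerivAt.fun_sum (u := Finset.univ) fun i _ => (h3 i).fun_mul (h2 i)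
  refine h.congr_deriv ?_
  set p := (γ t).1
  set v := (γ t).2
  have h4 : ∀ i, partialDeriv μ (b i) p = ∑ ρ, christoffel a ρ μ i p * b ρ p := fun i =>
    sub_eq_zero.mp (hpar p hγU μ i)
  simp only [h4, Finset.sum_add_distrib, mul_neg, Finset.sum_neg_distrib, Finset.sum_mul,
    Finset.mul_sum]
  rw [Finset.sum_comm, add_neg_eq_zero]
  refine Finset.sum_congr rfl fun i _ => Finset.sum_congr rfl fun j _ => ?_
  ring

/-- A function that depends only on `A = a_{μν} y^μ y^ν` and `β = b_μ y^μ` is annihilated by the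
horizontal derivatives of the Levi-Civita connection, if `b` is covariantly constant: `A` and `β`,
and with them the function, are constant along parallel transport. -/
theorem dX_eq_of_dependsOn (hD : IsOpen D) (hU : IsOpen U) (hDU : ∀ z ∈ D, z.1 ∈ U)
    (hF : ContDiffOn ℝ ∞ (uncurry F) D)
    (ha : ∀ i j, ContDiffOn ℝ ∞ (fun x => a x i j) U)
    (hsymm : ∀ x ∈ U, ∀ i j, a x i j = a x j i) (hdet : ∀ x ∈ U, IsUnit (a x).det)
    (hb : ∀ i, ContDiffOn ℝ ∞ (b i) U) (hpar : ∀ x ∈ U, ∀ μ ν, covariantDeriv a b μ ν x = 0)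
    (Ψ : ℝ → ℝ → ℝ) (hΨ : ∀ x y, (x, y) ∈ D →
      F x y = Ψ (∑ i, ∑ j, a x i j * (y i * y j)) (∑ i, b i x * y i))
    (hxy : (x, y) ∈ D) (μ : Fin 4) :
    dX μ F x y = ∑ ρ, (∑ ν, christoffel a ρ μ ν x * y ν) * dY ρ F x y := by
  have hdF : DifferentiableAt ℝ (uncurry F) (x, y) :=
    (hF.contDiffAt (hD.mem_nhds hxy)).differentiableAt (by simp)
  obtain ⟨γ, hγ0, ε, hε, hγ⟩ :=
    (contDiffAt_horizontalLift (y := y) hU (contDiffOn_christoffel hU ha hdet) (hDU _ hxy)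
      μ).exists_forall_mem_closedBall_exists_eq_forall_mem_Ioo_hasDerivAt₀ 0
  have h0 : HasDerivAt γ (horizontalLift (christoffel a) μ (x, y)) 0 := by
    have := hγ 0 (by simp [hε])
    rwa [hγ0] at this
  have hmem : ∀ᶠ t in 𝓝 (0 : ℝ), γ t ∈ D ∧
      HasDerivAt γ (horizontalLift (christoffel a) μ (γ t)) t :=
    (h0.continuousAt.eventually_mem (by rw [hγ0]; exact hD.mem_nhds hxy)).and
      (by filter_upwards [Ioo_mem_nhds (a := 0 - ε) (b := 0 + ε) (x := 0) (by simpa) (by simpa)]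
            with t ht using hγ t ht)
  obtain ⟨δ, hδ, hball⟩ := Metric.eventually_nhds_iff_ball.mp hmem
  have hconst : ∀ f : ℝ → ℝ, (∀ t ∈ Metric.ball (0 : ℝ) δ, HasDerivAt f 0 t) →
      ∀ t ∈ Metric.ball (0 : ℝ) δ, f t = f 0 := fun f hf t ht =>
    Metric.isOpen_ball.is_const_of_deriv_eq_zero (convex_ball (0 : ℝ) δ).isPreconnected
      (fun s hs => (hf s hs).differentiableAt.differentiableWithinAt)
      (fun s hs => (hf s hs).deriv) ht (Metric.mem_ball_self hδ)
  have hA := hconst _ fun t ht => hasDerivAt_quad hU ha hsymm hdet (hDU _ (hball t ht).1)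
    (hball t ht).2
  have hB := hconst _ fun t ht => hasDerivAt_oneForm hU hb hpar (hDU _ (hball t ht).1)
    (hball t ht).2
  have hFc : (fun t => uncurry F (γ t)) =ᶠ[𝓝 0] fun _ => uncurry F (γ 0) := by
    filter_upwards [Metric.ball_mem_nhds (0 : ℝ) hδ] with t ht
    have e1 := hΨ (γ t).1 (γ t).2 (hball t ht).1
    have e2 := hΨ (γ 0).1 (γ 0).2 (hball 0 (Metric.mem_ball_self hδ)).1
    rw [hA t ht, hB t ht, ← e2] at e1
    exact e1
  have hd1 : HasDerivAt (fun t => uncurry F (γ t))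
      (fderiv ℝ (uncurry F) (x, y) (horizontalLift (christoffel a) μ (x, y))) 0 := by
    have := hdF.hasFDerivAt
    rw [← hγ0] at this
    have h' := this.comp_hasDerivAt 0 h0
    rwa [hγ0] at h'
  -- Only smoothness of `F` enters here: `Ψ` need not be differentiable, or even continuous.
  have hz := hd1.unique ((hasDerivAt_const (0 : ℝ) (uncurry F (γ 0))).congr_of_eventuallyEq hFc)
  rw [fderiv_horizontalLift hdF] at hz
  exact sub_eq_zero.mp hz

end Transport

/-! ### The metric, the 1-form and the Finsler function in a chart -/

section Chart

variable {M : Type*} [TopologicalSpace M] [ChartedSpace E4 M] [IsManifold (𝓡 4) ∞ M]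
  {e : OpenPartialHomeomorph M E4} {x y : E4}

theorem contMDiffOn_coordVector (he : e ∈ IsManifold.maximalAtlas (𝓡 4) ∞ M) :
    ContMDiffOn 𝓘(ℝ, E4 × E4) (𝓡 4).tangent ∞
      (fun z : E4 × E4 => coordVector e z.1 z.2) {z | z.1 ∈ e.target} := by
  have h1 := (contMDiffOn_symm_of_mem_maximalAtlas he).contMDiffOn_tangentMapWithin (m := ∞)
    (by simp) e.open_target.uniqueMDiffOn
  have h2 : ContMDiff 𝓘(ℝ, E4 × E4) (𝓡 4).tangent ∞
      (fun z : E4 × E4 => (⟨z.1, z.2⟩ : TangentBundle (𝓡 4) E4)) := by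
    have h := contMDiff_tangentBundleModelSpaceHomeomorph_symm (I := 𝓡 4) (n := ∞)
    rw [modelWithCornersSelf_prod]
    exact h
  refine (h1.comp h2.contMDiffOn fun z hz => hz).congr fun z hz => ?_
  simp only [comp_apply, tangentMapWithin, coordVector]
  rw [mfderivWithin_of_isOpen e.open_target hz]

theorem contMDiffOn_coordVector_const (he : e ∈ IsManifold.maximalAtlas (𝓡 4) ∞ M) (v : E4) :
    ContMDiffOn (𝓡 4) (𝓡 4).tangent ∞ (fun x : E4 => coordVector e x v) e.target := by
  refine (contMDiffOn_coordVector he).comp (t := {z : E4 × E4 | z.1 ∈ e.target})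
    (f := fun x : E4 => (x, v)) ?_ fun x hx => hx
  exact (contDiff_prodMk_left v).contMDiff.contMDiffOn

theorem PseudoRiemannianMetric.contDiffOn_components (a : PseudoRiemannianMetric M)
    (he : e ∈ IsManifold.maximalAtlas (𝓡 4) ∞ M) (μ ν : Fin 4) :
    ContDiffOn ℝ ∞ (fun x => a.components e x μ ν) e.target := by
  rw [← contMDiffOn_iff_contDiffOn]
  have h := ContMDiffOn.clm_bundle_apply₂ (n := ∞) (F₁ := E4) (F₂ := E4) (F₃ := ℝ)
    (E₁ := (TangentSpace (𝓡 4) : M → Type _)) (E₂ := (TangentSpace (𝓡 4) : M → Type _))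
    (E₃ := Bundle.Trivial M ℝ) (b := e.symm) (s := e.target) (ψ := fun x => a.val (e.symm x))
    (a.smooth.comp_contMDiffOn (contMDiffOn_symm_of_mem_maximalAtlas he))
    (contMDiffOn_coordVector_const he (basisVec μ)) (contMDiffOn_coordVector_const he (basisVec ν))
  intro x hx
  exact (Bundle.contMDiffWithinAt_totalSpace.mp (h x hx)).2

theorem OneForm.contDiffOn_components (b : OneForm M)
    (he : e ∈ IsManifold.maximalAtlas (𝓡 4) ∞ M) (μ : Fin 4) :
    ContDiffOn ℝ ∞ (b.components e μ) e.target := by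
  rw [← contMDiffOn_iff_contDiffOn]
  have h := ContMDiffOn.clm_bundle_apply (n := ∞) (F₁ := E4) (F₂ := ℝ)
    (E₁ := (TangentSpace (𝓡 4) : M → Type _))
    (E₂ := Bundle.Trivial M ℝ) (b := e.symm) (s := e.target) (ϕ := fun x => b.val (e.symm x))
    (b.smooth.comp_contMDiffOn (contMDiffOn_symm_of_mem_maximalAtlas he))
    (contMDiffOn_coordVector_const he (basisVec μ))
  intro x hx
  exact (Bundle.contMDiffWithinAt_totalSpace.mp (h x hx)).2

theorem PseudoRiemannianMetric.val_mfderiv_symm (a : PseudoRiemannianMetric M)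
    (e : OpenPartialHomeomorph M E4) (x u y : E4) :
    a.val (e.symm x) (mfderiv (𝓡 4) (𝓡 4) e.symm x u) (mfderiv (𝓡 4) (𝓡 4) e.symm x y)
      = ∑ i, ∑ j, a.components e x i j * (u i * y j) :=
  bilinear_eq_sum_basisVec (ContinuousLinearMap.bilinearComp (E := E4) (F := E4) (E' := E4)
    (F' := E4) (a.val (e.symm x)) (mfderiv (𝓡 4) (𝓡 4) e.symm x)
    (mfderiv (𝓡 4) (𝓡 4) e.symm x)) u y

theorem PseudoRiemannianMetric.quad_coordVector (a : PseudoRiemannianMetric M)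
    (e : OpenPartialHomeomorph M E4) (x y : E4) :
    a.quad (coordVector e x y) = ∑ i, ∑ j, a.components e x i j * (y i * y j) :=
  a.val_mfderiv_symm e x y y

theorem OneForm.beta_coordVector (b : OneForm M) (e : OpenPartialHomeomorph M E4) (x y : E4) :
    b.beta (coordVector e x y) = ∑ i, b.components e i x * y i :=
  linear_eq_sum_basisVec (ContinuousLinearMap.comp (M₁ := E4) (M₂ := E4) (b.val (e.symm x))
    (mfderiv (𝓡 4) (𝓡 4) e.symm x)) y

theorem PseudoRiemannianMetric.components_symm (a : PseudoRiemannianMetric M)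
    (e : OpenPartialHomeomorph M E4) (x : E4) (i j : Fin 4) :
    a.components e x i j = a.components e x j i :=
  a.symm _ _ _

/-- The component matrix is invertible: a null vector of it would be mapped by the derivative of the
inverse chart to a null vector of the metric. -/
theorem PseudoRiemannianMetric.isUnit_det_components (a : PseudoRiemannianMetric M)
    (he : e ∈ IsManifold.maximalAtlas (𝓡 4) ∞ M) (hx : x ∈ e.target) :
    IsUnit (a.components e x).det := by
  have hsymm : e.symm.MDifferentiable (𝓡 4) (𝓡 4) :=
    ⟨(contMDiffOn_symm_of_mem_maximalAtlas he).mdifferentiableOn (by simp),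
      (contMDiffOn_of_mem_maximalAtlas he).mdifferentiableOn (by simp)⟩
  rw [isUnit_iff_ne_zero]
  intro h0
  obtain ⟨v, hv, hav⟩ := Matrix.exists_mulVec_eq_zero_iff.mpr h0
  refine hv ?_
  set J := mfderiv (𝓡 4) (𝓡 4) e.symm x with hJ
  have hzero : J (WithLp.toLp 2 v) = 0 := by
    refine a.nondegenerate _ _ fun w => ?_
    obtain ⟨(u : E4), rfl⟩ := hsymm.mfderiv_surjective (x := x) hx w
    rw [a.symm, hJ, a.val_mfderiv_symm e x u]
    refine Finset.sum_eq_zero fun i _ => ?_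
    have := congrFun hav i
    simp only [Matrix.mulVec, dotProduct, Pi.zero_apply] at this
    rw [← mul_zero (u i), ← this, Finset.mul_sum]
    exact Finset.sum_congr rfl fun j _ => by ring
  have := (hsymm.mfderiv_injective (x := x) hx) (hzero.trans (map_zero J).symm)
  exact (WithLp.toLp_eq_zero 2).mp this

end Chart

/-! ### Metrics built from `α` and `β` -/

section AlphaBeta

variable {M : Type*} [TopologicalSpace M] [ChartedSpace E4 M] [IsManifold (𝓡 4) ∞ M]
  {e : OpenPartialHomeomorph M E4} {x y : E4}

theorem IsLorentzian.isUnit_det {g : Matrix (Fin 4) (Fin 4) ℝ} (hg : IsLorentzian g) :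
    IsUnit g.det := by
  obtain ⟨P, -, h⟩ := hg
  have hm : minkowski.det = -1 := by simp [minkowski, Fin.prod_univ_four]
  have h' : P.det * g.det * P.det = -1 := by
    rcases h with h | h
    · simpa [hm] using congrArg Matrix.det h
    · simpa [hm, Matrix.det_neg, show (-1 : ℝ) ^ 4 = 1 by norm_num] using congrArg Matrix.det h
  rw [isUnit_iff_ne_zero]
  rintro h0
  simp [h0] at h'

/-- The part of the tangent bundle in which the Finsler metric lives, in the coordinates induced by
the chart `e`. -/
def FinslerSpacetime.coordDomain (S : FinslerSpacetime M) (e : OpenPartialHomeomorph M E4) :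
    Set (E4 × E4) :=
  {z | z.1 ∈ e.target ∧ coordVector e z.1 z.2 ∈ S.domain}

theorem FinslerSpacetime.isOpen_coordDomain (S : FinslerSpacetime M)
    (he : e ∈ IsManifold.maximalAtlas (𝓡 4) ∞ M) : IsOpen (S.coordDomain e) :=
  (contMDiffOn_coordVector he).continuousOn.isOpen_inter_preimage
    (e.open_target.preimage continuous_fst) S.isOpen_domain

theorem FinslerSpacetime.contDiffOn_inCoords (S : FinslerSpacetime M)
    (he : e ∈ IsManifold.maximalAtlas (𝓡 4) ∞ M) :
    ContDiffOn ℝ ∞ (uncurry (inCoords e S.F)) (S.coordDomain e) := by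
  rw [← contMDiffOn_iff_contDiffOn]
  exact S.smooth.comp ((contMDiffOn_coordVector he).mono fun z hz => hz.1) fun z hz => hz.2

/-- The Cartan connection of an `(α, β)`-metric with covariantly constant `b` is the Levi-Civita
connection of `a`. -/
theorem FinslerSpacetime.cartanConnection_eq_christoffel {S : FinslerSpacetime M}
    {a : PseudoRiemannianMetric M} {b : OneForm M} (hF : S.IsAlphaBetaMetric a b)
    (hb : b.IsCovariantlyConstant a) (he : e ∈ IsManifold.maximalAtlas (𝓡 4) ∞ M)
    (hxy : (x, y) ∈ S.coordDomain e) (ρ μ : Fin 4) :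
    cartanConnection (inCoords e S.F) ρ μ x y
      = ∑ ν, christoffel (a.components e) ρ μ ν x * y ν := by
  obtain ⟨Φ, hΦ⟩ := hF
  refine cartanConnection_eq (S.isOpen_coordDomain he) (S.contDiffOn_inCoords he)
    (fun x y h => (S.lorentzian e he x y h.1 h.2).isUnit_det)
    (fun x y h ρ μ ν => christoffel_symm e.open_target
      (fun x _ => a.components_symm e x) h.1 ρ μ ν)
    (fun x y h μ => ?_) hxy ρ μ
  refine dX_eq_of_dependsOn (S.isOpen_coordDomain he) e.open_target (fun z hz => hz.1)
    (S.contDiffOn_inCoords he) (a.contDiffOn_components he) (fun x _ => a.components_symm e x)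
    (fun x hx => a.isUnit_det_components he hx) (b.contDiffOn_components he) (hb e he)
    (fun A β => Φ (SignType.sign A) (√|A|) β) (fun x y h => ?_) h μ
  rw [← a.quad_coordVector, ← b.beta_coordVector]
  exact hΦ _ h.2

/-- The Finsler Ricci tensor vanishes identically, a fortiori its contraction in the field
equation. -/
theorem FinslerSpacetime.finslerRicciTensor_eq_zero {S : FinslerSpacetime M}
    {a : PseudoRiemannianMetric M} {b : OneForm M} (hF : S.IsAlphaBetaMetric a b)
    (ha : a.IsEinsteinVacuum) (hb : b.IsCovariantlyConstant a)
    (he : e ∈ IsManifold.maximalAtlas (𝓡 4) ∞ M)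
    (hxy : (x, y) ∈ S.coordDomain e) (μ ν : Fin 4) :
    finslerRicciTensor (inCoords e S.F) μ ν x y = 0 := by
  have hD := S.isOpen_coordDomain he
  have hRic : ∀ x y, (x, y) ∈ S.coordDomain e →
      finslerRicciScalar (inCoords e S.F) x y = (fun _ _ => 0 : E4 → E4 → ℝ) x y := by
    intro x y h
    rw [finslerRicciScalar_eq (a := a.components e) hD
      (fun x y h ρ μ ν => christoffel_symm e.open_target
        (fun x _ => a.components_symm e x) h.1 ρ μ ν)
      (fun x y h ρ μ ν => ((contDiffOn_christoffel e.open_target (a.contDiffOn_components he)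
        (fun x hx => a.isUnit_det_components he hx) ρ μ ν).contDiffAt
          (e.open_target.mem_nhds h.1)).differentiableAt (by simp))
      (fun x y h => cartanConnection_eq_christoffel hF hb he h) h]
    simp [ha e he x h.1]
  have h0 : ∀ (κ : Fin 4) (x y : E4), dY κ (fun _ _ => 0 : E4 → E4 → ℝ) x y = 0 := by
    simp [dY, partialDeriv]
  rw [finslerRicciTensor, dY_congr hD (g := fun _ _ => 0)
    (fun x y h => (dY_congr hD hRic h ν).trans (h0 ν x y)) hxy, h0, mul_zero]

end AlphaBeta

end FinslerGravity

theorem mainTheorem1 {M : Type*} [TopologicalSpace M] [ChartedSpace FinslerGravity.E4 M]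
    [IsManifold (𝓡 4) ∞ M] (S : FinslerGravity.FinslerSpacetime M)
    (a : FinslerGravity.PseudoRiemannianMetric M) (b : FinslerGravity.OneForm M)
    (hF : S.IsAlphaBetaMetric a b) (ha : a.IsEinsteinVacuum) (hb : b.IsCovariantlyConstant a) :
    S.IsBerwald ∧ S.SatisfiesBerwaldFieldEquation := by
  refine ⟨fun e he => ⟨FinslerGravity.christoffel (a.components e), fun x hx y hy ρ μ =>
    FinslerGravity.FinslerSpacetime.cartanConnection_eq_christoffel hF hb he ⟨hx, hy⟩ ρ μ⟩,
    fun e he x hx y hy => ?_⟩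
  simp [FinslerGravity.FinslerSpacetime.finslerRicciTensor_eq_zero hF ha hb he
    (show (x, y) ∈ S.coordDomain e from ⟨hx, hy⟩)]
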